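/- For integers $n\ge 0$ and $0\le k\le n$, let $\mathsf U_{k,n}$ be the uniform geometric lattice of rank $k$ on $n$ elements, i.e. the poset obtained from the Boolean algebra of all subsets of an $n$-element set, ordered by inclusion, by truncating it $n-k$ times, where truncating a bounded graded poset means removing all its coatoms. For a finite bounded graded poset $P$ with least element $\widehat 0$, greatest element $\widehat 1$, rank function $\rho$ and Möbius function $\mu$, put, for $x\le y$ in $P$, $\chi_{[x,y]}(t)=\sum_{x\le z\le y}\mu(x,z)\,t^{\rho(y)-\rho(z)}$; for $x<y$ put $\overline\chi_{[x,y]}(t)=\chi_{[x,y]}(t)/(t-1)$, which is a polynomial; and define the Chow polynomials recursively by $H_{[x,x]}(t)=1$ and $H_{[x,y]}(t)=\sum_{x<z\le y}\overline\chi_{[x,z]}(t)\,H_{[z,y]}(t)$ for $x<y$. The augmented Chow polynomial of $P$ is $$G_P(t)=\sum_{z\in P}t^{\rho(z)}\,H_{[z,\widehat 1]}(t).$$ Theorem. All complex zeros of the augmented Chow polynomial $G_{\mathsf U_{k,n}}(t)$ of a uniform geometric lattice $\mathsf U_{k,n}$ are real. -/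

import Mathlib

open Polynomial

/-! ### Chow polynomials of bounded graded posets

A bounded graded poset is modelled by Mathlib's classes `BoundedOrder P` and `GradeMinOrder ℕ P`.
The latter says that the rank function `grade ℕ : P → ℕ` is strictly monotone, increases by exactly
one along every covering relation, and is `0` at the minimal elements. The Möbius function is
Mathlib's `IncidenceAlgebra.mu`. -/

namespace Poset

section Chow

variable {P : Type*} [PartialOrder P] [LocallyFiniteOrder P] [DecidableEq P] [GradeMinOrder ℕ P]

/-- The characteristic polynomial `χ_{[x,y]}(t) = ∑_{x ≤ z ≤ y} μ(x,z) t^{ρ(y) - ρ(z)}`. -/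
noncomputable def charPoly (x y : P) : ℤ[X] :=
  ∑ z ∈ Finset.Icc x y, C (IncidenceAlgebra.mu ℤ x z) * X ^ (grade ℕ y - grade ℕ z)

/-- The reduced characteristic polynomial: `-1` if `x = y`, and `χ_{[x,y]}(t) / (t - 1)` otherwise
(the division is exact). -/
noncomputable def redCharPoly (x y : P) : ℤ[X] :=
  if x = y then -1 else charPoly x y /ₘ (X - C 1)

/-- The (characteristic) Chow function `H`, the inverse of `-χ̄` in the incidence algebra:
`H_{[x,x]} = 1` and `H_{[x,y]} = ∑_{x < z ≤ y} χ̄_{[x,z]} H_{[z,y]}` for `x < y`. -/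
noncomputable def chow (x y : P) : ℤ[X] :=
  if x = y then 1 else ∑ z ∈ (Finset.Ioc x y).attach, redCharPoly x z.1 * chow z.1 y
termination_by (Finset.Icc x y).card
decreasing_by
  have hz := Finset.mem_Ioc.1 z.2
  apply Finset.card_lt_card
  refine Finset.ssubset_iff_subset_ne.2 ⟨Finset.Icc_subset_Icc_left hz.1.le, fun h => ?_⟩
  have hx : x ∈ Finset.Icc z.1 y := h ▸ Finset.left_mem_Icc.2 (hz.1.le.trans hz.2)
  exact absurd (Finset.mem_Icc.1 hx).1 (not_le_of_gt hz.1)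

/-- The (left) augmented Chow function `G_{[x,y]}(t) = ∑_{x ≤ z ≤ y} t^{ρ(z) - ρ(x)} H_{[z,y]}(t)`. -/
noncomputable def augChow (x y : P) : ℤ[X] :=
  ∑ z ∈ Finset.Icc x y, X ^ (grade ℕ z - grade ℕ x) * chow z y

variable (P) in
/-- The augmented Chow polynomial `G_P(t)` of a bounded graded poset. -/
noncomputable def augmentedChowPolynomial [BoundedOrder P] : ℤ[X] :=
  augChow (⊥ : P) (⊤ : P)

end Chow

/-! ### Truncation

Posets are taken here as subsets `S` of an ambient poset, with the induced order. -/

section Truncation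

variable {α : Type*} [PartialOrder α]

/-- The coatoms of `S`: the elements covered, in the induced order, by the largest element of `S`. -/
def coatoms (S : Set α) : Set α :=
  {x | ∃ h : x ∈ S, ∃ t : S, IsTop t ∧ (⟨x, h⟩ : S) ⋖ t}

/-- The truncation of `S`: all coatoms are removed. -/
def truncation (S : Set α) : Set α := S \ coatoms S

end Truncation

/-! ### Uniform geometric lattices -/

/-- The uniform geometric lattice `U_{k,n}` (for `k ≤ n`): the Boolean algebra of all subsets of an
`n`-element set, ordered by inclusion, truncated `n - k` times. -/
def uniformSet (k n : ℕ) : Set (Finset (Fin n)) :=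
  truncation^[n - k] Set.univ

theorem mem_truncation_iterate {n : ℕ} (m : ℕ) (A : Finset (Fin n)) :
    A ∈ truncation^[m] (Set.univ : Set (Finset (Fin n))) ↔ A = Finset.univ ∨ A.card < n - m := by
  induction m generalizing A with
  | zero =>
    simp only [Function.iterate_zero, id_eq, Set.mem_univ, true_iff, Nat.sub_zero]
    by_cases h : A = Finset.univ
    · exact Or.inl h
    · right
      have := Finset.card_lt_univ_of_notMem (s := A)
        (x := (by simpa [Finset.eq_univ_iff_forall] using h : ∃ x, x ∉ A).choose)
        (by simpa [Finset.eq_univ_iff_forall] using h : ∃ x, x ∉ A).choose_spec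
      simpa using this
  | succ m ih =>
    rw [Function.iterate_succ_apply']
    set S := truncation^[m] (Set.univ : Set (Finset (Fin n))) with hS
    have hu : Finset.univ ∈ S := (ih _).2 (Or.inl rfl)
    have htop : ∀ t : S, IsTop t → t.1 = Finset.univ := fun t ht =>
      Finset.univ_subset_iff.1 (ht ⟨Finset.univ, hu⟩)
    constructor
    · rintro ⟨hA, hc⟩
      by_contra! hcon
      obtain ⟨hne, hcard⟩ := hcon
      have hlt : A.card < n - m := ((ih A).1 hA).resolve_left hne
      refine hc ⟨hA, ⟨Finset.univ, hu⟩, fun B => Finset.subset_univ _, ?_, ?_⟩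
      · exact Finset.ssubset_univ_iff.2 hne
      · rintro ⟨B, hB⟩ (hAB : A ⊂ B) (hBu : B ⊂ Finset.univ)
        have h1 := Finset.card_lt_card hAB
        have h2 := ((ih B).1 hB).resolve_left (Finset.ssubset_univ_iff.1 hBu)
        omega
    · rintro (rfl | h)
      · refine ⟨hu, ?_⟩
        rintro ⟨_, t, ht, hcov⟩
        have h1 := htop t ht
        exact hcov.lt.ne (Subtype.ext h1.symm)
      · have hA : A ∈ S := (ih A).2 (Or.inr (by omega))
        refine ⟨hA, ?_⟩
        rintro ⟨_, ⟨t, htS⟩, ht, hcov⟩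
        obtain rfl : t = Finset.univ := htop _ ht
        have hlt : A ⊂ Finset.univ := hcov.lt
        obtain ⟨x, -, hx⟩ := Finset.exists_of_ssubset hlt
        have hB : insert x A ∈ S := (ih _).2 (Or.inr (by
          rw [Finset.card_insert_of_notMem hx]; omega))
        refine hcov.2 (c := ⟨insert x A, hB⟩) (Finset.ssubset_insert hx) ?_
        refine Finset.ssubset_univ_iff.2 fun h2 => ?_
        have h3 := congrArg Finset.card h2
        rw [Finset.card_insert_of_notMem hx, Finset.card_univ, Fintype.card_fin] at h3
        omega

theorem mem_uniformSet {k n : ℕ} (A : Finset (Fin n)) :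
    A ∈ uniformSet k n ↔ A = Finset.univ ∨ A.card < min k n := by
  rw [uniformSet, mem_truncation_iterate]
  have : n - (n - k) = min k n := by omega
  rw [this]

/-- `U_{k,n}` as a type, ordered by inclusion. -/
def Uniform (k n : ℕ) : Type := uniformSet k n

namespace Uniform

variable {k n : ℕ}

instance : PartialOrder (Uniform k n) := inferInstanceAs (PartialOrder (uniformSet k n))

instance : DecidableEq (Uniform k n) := inferInstanceAs (DecidableEq (uniformSet k n))

noncomputable instance : Fintype (Uniform k n) :=
  letI : Finite (Uniform k n) := inferInstanceAs (Finite (uniformSet k n))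
  Fintype.ofFinite _

open Classical in
noncomputable instance : LocallyFiniteOrder (Uniform k n) := Fintype.toLocallyFiniteOrder

/-- The least element is the empty set, except in rank `0`, where `U_{0,n}` is a single point. -/
instance : BoundedOrder (Uniform k n) where
  top := ⟨Finset.univ, (mem_uniformSet _).2 (Or.inl rfl)⟩
  le_top A := Finset.subset_univ A.1
  bot := ⟨if 0 < min k n then ∅ else Finset.univ, by
    rw [mem_uniformSet]
    split_ifs with h
    · exact Or.inr (by rwa [Finset.card_empty])
    · exact Or.inl rfl⟩
  bot_le A := by
    change (if 0 < min k n then ∅ else Finset.univ : Finset (Fin n)) ⊆ A.1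
    split_ifs with h
    · exact Finset.empty_subset A.1
    · obtain hA | hA := (mem_uniformSet A.1).1 A.2
      · exact hA.ge
      · omega

/-- The rank of a proper subset in `U_{k,n}` is its cardinality, that of the top element is `k`
(for `k ≤ n`). -/
instance : GradeMinOrder ℕ (Uniform k n) where
  grade A := if A.1 = Finset.univ then min k n else A.1.card
  grade_strictMono := by
    intro A B hAB
    have hAB' : A.1 ⊂ B.1 := hAB
    have hA : A.1 ≠ Finset.univ := Finset.ssubset_univ_iff.1
      (hAB'.trans_subset (Finset.subset_univ _))
    have h1 := ((mem_uniformSet A.1).1 A.2).resolve_left hA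
    dsimp only
    rw [if_neg hA]
    split_ifs
    · exact h1
    · exact Finset.card_lt_card hAB'
  covBy_grade := by
    intro A B hAB
    have hAB' : A.1 ⊂ B.1 := hAB.lt
    have hA : A.1 ≠ Finset.univ := Finset.ssubset_univ_iff.1
      (hAB'.trans_subset (Finset.subset_univ _))
    have h1 := ((mem_uniformSet A.1).1 A.2).resolve_left hA
    obtain ⟨x, hxB, hx⟩ := Finset.exists_of_ssubset hAB'
    have hcard := Finset.card_insert_of_notMem hx
    rw [Nat.covBy_iff_add_one_eq, if_neg hA]
    by_cases hlt : A.1.card + 1 < min k n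
    · have hC : insert x A.1 ∈ uniformSet k n := (mem_uniformSet _).2 (Or.inr (by omega))
      have hCB : insert x A.1 ⊆ B.1 := Finset.insert_subset hxB hAB'.subset
      have heq : insert x A.1 = B.1 := by
        by_contra hne
        exact hAB.2 (c := ⟨insert x A.1, hC⟩) (Finset.ssubset_insert hx)
          (Finset.ssubset_iff_subset_ne.2 ⟨hCB, hne⟩)
      have hBu : B.1 ≠ Finset.univ := by
        intro h
        have h3 := congrArg Finset.card (heq.trans h)
        rw [Finset.card_univ, Fintype.card_fin] at h3
        omega
      rw [if_neg hBu, ← heq, hcard]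
    · have hBu : B.1 = Finset.univ := by
        refine ((mem_uniformSet B.1).1 B.2).resolve_right fun h => ?_
        have := Finset.card_lt_card hAB'
        omega
      rw [if_pos hBu]
      omega
  isMin_grade := by
    intro A hA
    have hbot : A = ⊥ := hA.eq_bot
    rw [isMin_iff_eq_bot, hbot]
    by_cases h : 0 < min k n
    · have h0 : (⊥ : Uniform k n).1 = ∅ := if_pos h
      have hne : (∅ : Finset (Fin n)) ≠ Finset.univ := by
        intro h2
        have h3 := congrArg Finset.card h2
        rw [Finset.card_univ, Fintype.card_fin, Finset.card_empty] at h3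
        omega
      rw [h0, if_neg hne]
      rfl
    · have h0 : (⊥ : Uniform k n).1 = Finset.univ := if_neg h
      rw [h0, if_pos rfl]
      simp only [Nat.bot_eq_zero]
      omega

end Uniform

end Poset

/-! ### A pointwise substitute for interlacing. -/

open ComplexConjugate

/-! Fix a nonreal `t` and put `M = n - k`, `w = t / (1 + t) ^ 2`. The value of the augmented Chow
polynomial at `t` is `(1 + t) ^ k` times the entry `f_k (M + k)` of the recursion `levels M w`, so
it suffices that this entry is nonzero.

Nonvanishing: since `t` is nonreal, `w` is not a nonpositive real. The relation `ConeRel w a b`,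
written `a ≪ b`, replaces interlacing of polynomials by a condition on their values at `w`: it is
additive in both arguments, and `a ≪ b` gives `b ≪ w a`. The recursion preserves a system of such
relations (`Interlace.step`), and `a ≪ b` with `a + b = 0` forces `a = 0`, so the last entry never
vanishes.

Identification: Möbius inversion gives a second formula for `G` in terms of `H` (`augChow_eq`).
Equating it with the definition determines `H` recursively from the top, because `1 - t ≠ 0`. The
sequences built from `levels` satisfy both formulas, by telescoping one three-term relation with
weights `1` and `t ^ i`. -/

/-- `b * conj a` lies in the convex cone spanned by `1` and `w`. -/
def ConeRel (w a b : ℂ) : Prop :=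
  ∃ x y : ℝ, 0 ≤ x ∧ 0 ≤ y ∧ b * conj a = x + y * w

namespace ConeRel

variable {w a b c : ℂ}

theorem refl (w a : ℂ) : ConeRel w a a :=
  ⟨Complex.normSq a, 0, Complex.normSq_nonneg a, le_rfl, by simp [Complex.mul_conj]⟩

theorem zero_left (w b : ℂ) : ConeRel w 0 b := ⟨0, 0, le_rfl, le_rfl, by simp⟩

theorem zero_right (w a : ℂ) : ConeRel w a 0 := ⟨0, 0, le_rfl, le_rfl, by simp⟩

theorem add_right (h₁ : ConeRel w a b) (h₂ : ConeRel w a c) : ConeRel w a (b + c) := by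
  obtain ⟨x, y, hx, hy, h⟩ := h₁
  obtain ⟨x', y', hx', hy', h'⟩ := h₂
  refine ⟨x + x', y + y', add_nonneg hx hx', add_nonneg hy hy', ?_⟩
  push_cast
  rw [add_mul, h, h']
  ring

theorem add_left (h₁ : ConeRel w a c) (h₂ : ConeRel w b c) : ConeRel w (a + b) c := by
  obtain ⟨x, y, hx, hy, h⟩ := h₁
  obtain ⟨x', y', hx', hy', h'⟩ := h₂
  refine ⟨x + x', y + y', add_nonneg hx hx', add_nonneg hy hy', ?_⟩
  push_cast
  rw [map_add, mul_add, h, h']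
  ring

/-- `a ≪ b` implies `b ≪ w a`. -/
theorem mul_left_swap (h : ConeRel w a b) : ConeRel w b (w * a) := by
  obtain ⟨x, y, hx, hy, h⟩ := h
  refine ⟨y * Complex.normSq w, x, mul_nonneg hy (Complex.normSq_nonneg w), hx, ?_⟩
  have h' := congrArg conj h
  simp only [map_mul, map_add, Complex.conj_conj, Complex.conj_ofReal] at h'
  push_cast
  rw [← Complex.mul_conj]
  linear_combination w * h'

theorem mul_mul (h : ConeRel w a b) : ConeRel w (w * a) (w * b) :=
  h.mul_left_swap.mul_left_swap

theorem sum_right {ι : Type*} {s : Finset ι} {g : ι → ℂ} (h : ∀ i ∈ s, ConeRel w a (g i)) :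
    ConeRel w a (∑ i ∈ s, g i) :=
  Finset.sum_induction g (ConeRel w a) (fun _ _ => add_right) (zero_right w a) h

theorem sum_sum {ι κ : Type*} {s : Finset ι} {s' : Finset κ} {g : ι → ℂ} {g' : κ → ℂ}
    (h : ∀ i ∈ s, ∀ j ∈ s', ConeRel w (g i) (g' j)) :
    ConeRel w (∑ i ∈ s, g i) (∑ j ∈ s', g' j) :=
  Finset.sum_induction g (fun x => ConeRel w x _) (fun _ _ => add_left) (zero_left w _)
    fun i hi => sum_right (h i hi)

/-- With `b = -a` the relation reads `-|a|² = x + y w`; if `a ≠ 0`, this makes `w` a nonpositive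
real. -/
theorem eq_zero_of_add_eq_zero (hw : ∀ c : ℝ, 0 ≤ c → w ≠ -c) (h : ConeRel w a b)
    (hab : a + b = 0) : a = 0 := by
  obtain ⟨x, y, hx, hy, h⟩ := h
  rw [eq_neg_of_add_eq_zero_right hab, neg_mul, Complex.mul_conj] at h
  by_contra ha
  have hpos : 0 < Complex.normSq a := Complex.normSq_pos.2 ha
  rcases hy.eq_or_lt with rfl | hy
  · have h' := congrArg Complex.re h
    simp at h'
    linarith
  · refine hw ((Complex.normSq a + x) / y) (by positivity) ?_
    have hy' : (y : ℂ) ≠ 0 := by exact_mod_cast hy.ne'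
    push_cast
    field_simp
    linear_combination -h

end ConeRel

/-! ### The recursion and its nonvanishing. -/

/-- The pairs `(f_r, d_r)` of sequences with `f_0 = δ_M`, `d_0 = 0`, and, where `e = f + d`,
`f_{r+1}(j) = ∑_{i < j} e_r(i)` and `d_{r+1}(j) = w ∑_{j ≤ i ≤ M + r} f_r(i)`. Up to scaling and
the order of the letters, they enumerate permutations without double descents by their first
letter. -/
noncomputable def levels (M : ℕ) (w : ℂ) : ℕ → (ℕ → ℂ) × (ℕ → ℂ)
  | 0 => (fun j => if j = M then 1 else 0, fun _ => 0)
  | r + 1 =>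
    (fun j => ∑ i ∈ Finset.range j, ((levels M w r).1 i + (levels M w r).2 i),
     fun j => w * ∑ i ∈ Finset.Ico j (M + 1 + r), (levels M w r).1 i)

section Interlacing

variable {w : ℂ} {m : ℕ} {f d : ℕ → ℂ}

/-- The interlacing relations between the entries `f_i`, `d_i` with `i < m`. -/
structure Interlace (w : ℂ) (m : ℕ) (f d : ℕ → ℂ) : Prop where
  add_add : ∀ i l, l ≤ i → i < m → ConeRel w (f i + d i) (f l + d l)
  left_left : ∀ i l, l ≤ i → i < m → ConeRel w (f i) (f l)
  left_right : ∀ i l, i < m → l < m → ConeRel w (f i) (d l)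

theorem Interlace.left_add (h : Interlace w m f d) {i l : ℕ} (hl : l ≤ i) (hi : i < m) :
    ConeRel w (f i) (f l + d l) :=
  (h.left_left i l hl hi).add_right (h.left_right i l hi (hl.trans_lt hi))

/-- Split the sums at `l` and `j`. Between disjoint blocks the relations hold termwise; overlaps are
covered by `ConeRel.refl` and `block`, the latter needing `left_right` for all pairs of indices. -/
theorem Interlace.step (h : Interlace w m f d) :
    Interlace w (m + 1) (fun j => ∑ i ∈ Finset.range j, (f i + d i))
      (fun j => w * ∑ i ∈ Finset.Ico j m, f i) := by
  have split : ∀ (g : ℕ → ℂ) {l j : ℕ}, l ≤ j →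
      ∑ i ∈ Finset.range j, g i = ∑ i ∈ Finset.range l, g i + ∑ i ∈ Finset.Ico l j, g i :=
    fun g l j hl => (Finset.sum_range_add_sum_Ico g hl).symm
  have split' : ∀ (g : ℕ → ℂ) {l j : ℕ}, l ≤ j → j ≤ m →
      ∑ i ∈ Finset.Ico l m, g i = ∑ i ∈ Finset.Ico l j, g i + ∑ i ∈ Finset.Ico j m, g i :=
    fun g l j hl hj => (Finset.sum_Ico_consecutive g hl hj).symm
  have block : ∀ {l j : ℕ}, j ≤ m → ConeRel w (∑ i ∈ Finset.Ico l j, f i)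
      (∑ i ∈ Finset.Ico l j, (f i + d i)) := by
    intro l j hj
    rw [Finset.sum_add_distrib]
    refine (ConeRel.refl w _).add_right (ConeRel.sum_sum fun i hi i' hi' => ?_)
    rw [Finset.mem_Ico] at hi hi'
    exact h.left_right i i' (by omega) (by omega)
  refine ⟨fun j l hlj hj => ?_, fun j l hlj hj => ?_, fun j l hj hl => ?_⟩
  · have hj : j ≤ m := by omega
    rw [split _ hlj, split' f hlj hj, mul_add]
    -- The two entries are `(C + w A) + B` at `j` and `(C + w A) + w B'` at `l`, so four relations
    -- between summands suffice.
    set A := ∑ i ∈ Finset.Ico j m, f i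
    set B := ∑ i ∈ Finset.Ico l j, (f i + d i)
    set B' := ∑ i ∈ Finset.Ico l j, f i
    set C := ∑ i ∈ Finset.range l, (f i + d i)
    have hAB : ConeRel w A B := ConeRel.sum_sum fun i hi i' hi' => by
      rw [Finset.mem_Ico] at hi hi'
      exact h.left_add (by omega) (by omega)
    have hBC : ConeRel w B C := ConeRel.sum_sum fun i hi i' hi' => by
      rw [Finset.mem_Ico] at hi
      rw [Finset.mem_range] at hi'
      exact h.add_add i i' (by omega) (by omega)
    have hAB' : ConeRel w A B' := ConeRel.sum_sum fun i hi i' hi' => by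
      rw [Finset.mem_Ico] at hi hi'
      exact h.left_left i i' (by omega) (by omega)
    have hB'C : ConeRel w B' C := ConeRel.sum_sum fun i hi i' hi' => by
      rw [Finset.mem_Ico] at hi
      rw [Finset.mem_range] at hi'
      exact h.left_add (by omega) (by omega)
    have h1 : ConeRel w (C + w * A) (C + w * A) := ConeRel.refl w _
    have h2 : ConeRel w (C + w * A) (w * B') := hB'C.mul_left_swap.add_left hAB'.mul_mul
    have h3 : ConeRel w B (C + w * A) := hBC.add_right hAB.mul_left_swap
    have h4 : ConeRel w B (w * B') := (block hj).mul_left_swap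
    have h5 := (h1.add_right h2).add_left (h3.add_right h4)
    convert h5 using 1 <;> ring
  · have hj : j ≤ m := by omega
    rw [split _ hlj]
    refine (ConeRel.refl w _).add_left (ConeRel.sum_sum fun i hi i' hi' => ?_)
    rw [Finset.mem_Ico] at hi
    rw [Finset.mem_range] at hi'
    exact h.add_add i i' (by omega) (by omega)
  · refine ConeRel.mul_left_swap ?_
    rcases le_total j l with hjl | hlj
    · refine ConeRel.sum_sum fun i hi i' hi' => ?_
      rw [Finset.mem_Ico] at hi
      rw [Finset.mem_range] at hi'
      exact h.left_add (by omega) (by omega)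
    -- Both sums contain the indices in `[l, j)`; that pair is `block`, and in the other three pairs
    -- the left indices lie above the right ones.
    · rw [split _ hlj, split' f hlj (by omega)]
      refine ConeRel.add_left (ConeRel.add_right ?_ (block (by omega)))
        (ConeRel.add_right ?_ ?_) <;> refine ConeRel.sum_sum fun i hi i' hi' => ?_ <;>
        simp only [Finset.mem_Ico, Finset.mem_range] at hi hi' <;>
        exact h.left_add (by omega) (by omega)

theorem interlace_levels (M : ℕ) (w : ℂ) (r : ℕ) :
    Interlace w (M + 1 + r) (levels M w r).1 (levels M w r).2 := by
  induction r with
  | zero =>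
    have key : ∀ i l, l ≤ i → i < M + 1 + 0 →
        ConeRel w (if i = M then 1 else 0) (if l = M then 1 else 0) := by
      intro i l hl hi
      by_cases h : l = M
      · rw [show i = l by omega]
        exact ConeRel.refl w _
      · rw [if_neg h]
        exact ConeRel.zero_right w _
    refine ⟨fun i l hl hi => ?_, key, fun i l _ _ => ConeRel.zero_right w _⟩
    simpa [levels] using key i l hl hi
  | succ r ih => exact ih.step

theorem levels_last_ne_zero (M : ℕ) (hw : ∀ c : ℝ, 0 ≤ c → w ≠ -c) (r : ℕ) :
    (levels M w r).1 (M + r) ≠ 0 := by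
  induction r with
  | zero => simp [levels]
  | succ r ih =>
    -- The sum defining `d_r` is empty at the last index, so there `e_r = f_r` and the induction
    -- closes.
    have hd : (levels M w r).2 (M + r) = 0 := by
      cases r with
      | zero => rfl
      | succ r =>
        simp only [levels]
        rw [Finset.Ico_eq_empty (by omega), Finset.sum_empty, mul_zero]
    have hI := interlace_levels M w r
    intro h0
    simp only [levels] at h0
    rw [← add_assoc, Finset.sum_range_succ, add_comm] at h0
    have hR : ConeRel w ((levels M w r).1 (M + r) + (levels M w r).2 (M + r))
        (∑ i ∈ Finset.range (M + r), ((levels M w r).1 i + (levels M w r).2 i)) :=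
      ConeRel.sum_right fun i hi => by
        rw [Finset.mem_range] at hi
        exact hI.add_add _ _ (by omega) (by omega)
    have := hR.eq_zero_of_add_eq_zero hw h0
    rw [hd, add_zero] at this
    exact ih this

end Interlacing

/-! ### A second formula for the augmented Chow function. -/

namespace Poset

section General

theorem sum_Icc_Icc_comm {P M : Type*} [PartialOrder P] [LocallyFiniteOrder P]
    [AddCommMonoid M] (x y : P) (F : P → P → M) :
    ∑ z ∈ Finset.Icc x y, ∑ w ∈ Finset.Icc z y, F z w =
      ∑ w ∈ Finset.Icc x y, ∑ z ∈ Finset.Icc x w, F z w := by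
  refine Finset.sum_comm' fun z w => ?_
  simp only [Finset.mem_Icc]
  exact ⟨fun h => ⟨⟨h.1.1, h.2.1⟩, h.1.1.trans h.2.1, h.2.2⟩,
    fun h => ⟨⟨h.1.1, h.1.2.trans h.2.2⟩, h.1.2, h.2.2⟩⟩

variable {P : Type*} [PartialOrder P] [LocallyFiniteOrder P] [DecidableEq P] [GradeMinOrder ℕ P]

theorem X_sub_one_mul_redCharPoly {x z : P} (h : x < z) :
    (X - C 1) * redCharPoly x z = charPoly x z := by
  rw [redCharPoly, if_neg h.ne, mul_divByMonic_eq_iff_isRoot, IsRoot, charPoly, eval_finsetSum]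
  simpa [h.ne] using IncidenceAlgebra.sum_Icc_mu_right (𝕜 := ℤ) x z

theorem charPoly_self (x : P) : charPoly x x = 1 := by
  simp [charPoly]

theorem sum_charPoly_mul_chow {x y : P} (h : x < y) :
    ∑ z ∈ Finset.Icc x y, charPoly x z * chow z y = X * chow x y := by
  rw [← Finset.Ioc_insert_left h.le, Finset.sum_insert Finset.left_notMem_Ioc, charPoly_self,
    one_mul]
  have hc : (X - C 1) * chow x y = ∑ z ∈ Finset.Ioc x y, charPoly x z * chow z y := by
    rw [chow, if_neg h.ne, Finset.sum_attach (Finset.Ioc x y)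
      (fun z => redCharPoly x z * chow z y), Finset.mul_sum]
    refine Finset.sum_congr rfl fun z hz => ?_
    rw [← mul_assoc, X_sub_one_mul_redCharPoly (Finset.mem_Ioc.1 hz).1]
  rw [← hc, C_1]
  ring

theorem chow_self (x : P) : chow x x = 1 := by
  rw [chow, if_pos rfl]

theorem sum_mu_mul_augChow (x y : P) :
    ∑ z ∈ Finset.Icc x y, C (IncidenceAlgebra.mu ℤ x z) * augChow z y =
      ∑ z ∈ Finset.Icc x y, charPoly x z * chow z y := by
  simp_rw [augChow, charPoly, Finset.mul_sum, Finset.sum_mul, sum_Icc_Icc_comm, mul_assoc]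

/-- In the incidence algebra `μ * G = χ * H`, since `χ` is `μ` convolved with the powers of `X`. The
defining recursion of `H` makes `χ * H` equal to `X H` off the diagonal and `1` on it; convolving
with `ζ` recovers `G`. -/
theorem augChow_eq {x y : P} (h : x ≤ y) :
    augChow x y = X * ∑ z ∈ Finset.Icc x y, chow z y + (1 - X) := by
  have h1 : augChow x y = ∑ z ∈ Finset.Icc x y, ∑ w ∈ Finset.Icc z y,
      C (IncidenceAlgebra.mu ℤ z w) * augChow w y := by
    rw [sum_Icc_Icc_comm]
    simp_rw [← Finset.sum_mul]
    rw [Finset.sum_eq_single_of_mem x (Finset.left_mem_Icc.2 h)]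
    · simp
    · intro w _ hw
      rw [← map_sum, IncidenceAlgebra.sum_Icc_mu_left, if_neg hw.symm, C_0, zero_mul]
  have h2 : ∀ z ∈ Finset.Icc x y, ∑ w ∈ Finset.Icc z y,
      C (IncidenceAlgebra.mu ℤ z w) * augChow w y =
        X * chow z y + if z = y then 1 - X else 0 := by
    intro z hz
    rw [sum_mu_mul_augChow]
    split_ifs with hzy
    · subst hzy
      simp [charPoly_self, chow_self]
    · rw [sum_charPoly_mul_chow (lt_of_le_of_ne (Finset.mem_Icc.1 hz).2 hzy), add_zero]
  rw [h1, Finset.sum_congr rfl h2, Finset.sum_add_distrib, ← Finset.mul_sum,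
    Finset.sum_ite_eq' _ y, if_pos (Finset.right_mem_Icc.2 h)]

end General

/-! ### Upper intervals of uniform lattices. -/

namespace Uniform

variable {k n : ℕ}

theorem grade_top (hkn : k ≤ n) : grade ℕ (⊤ : Uniform k n) = k := by
  change (if (Finset.univ : Finset (Fin n)) = Finset.univ then min k n else _) = k
  rw [if_pos rfl, min_eq_left hkn]

theorem grade_of_ne_top {A : Uniform k n} (h : A ≠ ⊤) : grade ℕ A = A.1.card :=
  if_neg fun h' => h (Subtype.ext h')

theorem card_lt_of_ne_top (hkn : k ≤ n) {A : Uniform k n} (h : A ≠ ⊤) : A.1.card < k := by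
  have := ((mem_uniformSet A.1).1 A.2).resolve_left fun h' => h (Subtype.ext h')
  omega

/-- Elements of `[A, ⊤)` are `A ∪ S` with `S` a small subset of the complement of `A`. Thus upper
intervals are again uniform, of the same corank `n - k`. -/
theorem sum_Ico_top {M : Type*} [AddCommMonoid M] (hkn : k ≤ n) {A : Uniform k n}
    (hA : A ≠ ⊤) (F : ℕ → M) :
    ∑ B ∈ Finset.Ico A ⊤, F (grade ℕ B - grade ℕ A) =
      ∑ i ∈ Finset.range (k - grade ℕ A), (n - grade ℕ A).choose i • F i := by
  have hlt := card_lt_of_ne_top hkn hA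
  rw [grade_of_ne_top hA]
  have h1 : ∑ B ∈ Finset.Ico A ⊤, F (grade ℕ B - A.1.card) =
      ∑ S ∈ (A.1ᶜ).powerset with S.card < k - A.1.card, F S.card := by
    refine Finset.sum_bij' (fun B _ => B.1 \ A.1)
      (fun S hS => (⟨A.1 ∪ S, (mem_uniformSet _).2 (Or.inr ?_)⟩ : Uniform k n))
      ?_ ?_ ?_ ?_ ?_
    · rw [Finset.mem_filter] at hS
      have := Finset.card_union_le A.1 S
      omega
    · intro B hB
      rw [Finset.mem_Ico] at hB
      have hAB : A.1 ⊆ B.1 := hB.1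
      have := card_lt_of_ne_top hkn hB.2.ne
      have := Finset.card_le_card hAB
      rw [Finset.mem_filter, Finset.mem_powerset, Finset.card_sdiff_of_subset hAB]
      refine ⟨fun x hx => ?_, by omega⟩
      rw [Finset.mem_sdiff] at hx
      exact Finset.mem_compl.2 hx.2
    · intro S hS
      rw [Finset.mem_filter] at hS
      refine Finset.mem_Ico.2 ⟨show A.1 ⊆ A.1 ∪ S from Finset.subset_union_left, lt_top_iff_ne_top.2 fun h => ?_⟩
      have h' : A.1 ∪ S = Finset.univ := congrArg Subtype.val h
      have h2 := Finset.card_union_le A.1 S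
      rw [h', Finset.card_univ, Fintype.card_fin] at h2
      omega
    · intro B hB
      exact Subtype.ext (Finset.union_sdiff_of_subset (Finset.mem_Ico.1 hB).1)
    · intro S hS
      rw [Finset.mem_filter, Finset.mem_powerset] at hS
      exact Finset.union_sdiff_cancel_left (Finset.subset_compl_iff_disjoint_left.1 hS.1)
    · intro B hB
      rw [Finset.mem_Ico] at hB
      rw [grade_of_ne_top hB.2.ne, Finset.card_sdiff_of_subset hB.1]
  rw [h1, Finset.sum_filter, Finset.sum_powerset_apply_card
    (fun c => if c < k - A.1.card then F c else 0), Finset.card_compl, Fintype.card_fin]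
  simp_rw [smul_ite, smul_zero]
  rw [← Finset.sum_filter]
  refine Finset.sum_congr ?_ fun _ _ => rfl
  ext i
  simp only [Finset.mem_filter, Finset.mem_range]
  omega

theorem sum_Icc_top {M : Type*} [AddCommMonoid M] (hkn : k ≤ n) {A : Uniform k n}
    (hA : A ≠ ⊤) (F : ℕ → M) :
    ∑ B ∈ Finset.Icc A ⊤, F (grade ℕ B - grade ℕ A) =
      F (k - grade ℕ A) +
        ∑ i ∈ Finset.range (k - grade ℕ A), (n - grade ℕ A).choose i • F i := by
  rw [← Finset.Ico_insert_right le_top, Finset.sum_insert Finset.right_notMem_Ico,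
    sum_Ico_top hkn hA, grade_top hkn]

end Uniform

end Poset

/-! ### Partial sums and the three-term relation. -/

/-- The operator sending a sequence to its sequence of partial sums. -/
noncomputable def prefixSum : Module.End ℂ (ℕ → ℂ) where
  toFun v j := ∑ i ∈ Finset.range j, v i
  map_add' u v := by
    funext j
    simp [Finset.sum_add_distrib]
  map_smul' c v := by
    funext j
    simp [Finset.mul_sum]

theorem prefixSum_apply (v : ℕ → ℂ) (j : ℕ) : prefixSum v j = ∑ i ∈ Finset.range j, v i := rfl

theorem prefixSum_pow_of_const {m : ℕ} {v : ℕ → ℂ} {c : ℂ} (h : ∀ j ≤ m, v j = c) (i : ℕ) :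
    ∀ j ≤ m + i, (prefixSum ^ i) v j = c * j.choose i := by
  induction i with
  | zero => intro j hj; simpa using h j hj
  | succ i ih =>
    intro j hj
    rw [pow_succ', Module.End.mul_apply, prefixSum_apply,
      Finset.sum_congr rfl fun l hl => ih l (by rw [Finset.mem_range] at hl; omega),
      ← Finset.mul_sum]
    congr 1
    clear hj
    induction j with
    | zero => simp
    | succ j ihj =>
      rw [Finset.sum_range_succ, ihj, Nat.choose_succ_succ']
      push_cast
      ring

theorem prefixSum_pow_single (M i : ℕ) :
    ∀ j ≤ M + i, (prefixSum ^ i) (fun j => if j = M then 1 else 0) j =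
      if j = M + i then 1 else 0 := by
  induction i with
  | zero => intro j _; simp
  | succ i ih =>
    intro j hj
    rw [pow_succ', Module.End.mul_apply, prefixSum_apply,
      Finset.sum_congr rfl fun l hl => ih l (by rw [Finset.mem_range] at hl; omega),
      Finset.sum_ite_eq']
    refine if_congr ?_ rfl rfl
    rw [Finset.mem_range]
    omega

theorem levels_succ_fst (M : ℕ) (w : ℂ) (r : ℕ) :
    (levels M w (r + 1)).1 = prefixSum ((levels M w r).1 + (levels M w r).2) := rfl

/-- The partial sums of `f_r` and the tail sums `q` add up to a constant, so iterated summation of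
them gives a binomial coefficient. As `d_{r+1} = w q`, the tails are eliminated through `f_{r+2}`,
with `w s² = t`. -/
theorem levels_three_term (M r i : ℕ) {w s t : ℂ} (hw : w * s ^ 2 = t) :
    t * ((M + r + i + 2).choose (i + 1) *
        (s ^ r * prefixSum (levels M w r).1 (M + 1 + r))) =
      t * (s ^ r * (prefixSum ^ (i + 2)) (levels M w r).1 (M + r + i + 2))
        - s * (s ^ (r + 1) * (prefixSum ^ (i + 1)) (levels M w (r + 1)).1 (M + r + i + 2))
        + s ^ (r + 2) * (prefixSum ^ i) (levels M w (r + 2)).1 (M + r + i + 2) := by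
  set f := (levels M w r).1 with hf
  set n := M + r + i + 2 with hn
  set q : ℕ → ℂ := fun j => ∑ l ∈ Finset.Ico j (M + 1 + r), f l with hq
  have hd : (levels M w (r + 1)).2 = w • q := rfl
  have h1 := prefixSum_pow_of_const (m := M + 1 + r) (v := prefixSum f + q)
    (c := prefixSum f (M + 1 + r))
    (fun j hj => Finset.sum_range_add_sum_Ico f hj) (i + 1) n (by omega)
  rw [map_add, ← Module.End.mul_apply, ← pow_succ, Pi.add_apply] at h1
  have h2 : (prefixSum ^ i) (levels M w (r + 2)).1 n =
      (prefixSum ^ (i + 1)) (levels M w (r + 1)).1 n + w * (prefixSum ^ (i + 1)) q n := by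
    rw [levels_succ_fst, ← Module.End.mul_apply, ← pow_succ, map_add, hd, map_smul]
    rfl
  rw [h2]
  linear_combination (-t * s ^ r) * h1 - (s ^ r * (prefixSum ^ (i + 1)) q n) * hw

/-- The values at `t` of the Chow polynomials of the upper intervals, of rank `j`, in a uniform
geometric lattice of corank `M`. -/
noncomputable def chowSeq (M : ℕ) (t : ℂ) (j : ℕ) : ℂ :=
  if j = 0 then 1
  else (1 + t) ^ (j - 1) * prefixSum (levels M (t / (1 + t) ^ 2) (j - 1)).1 (M + j)

/-- The values at `t` of the augmented Chow polynomials of the upper intervals, of rank `j`, in a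
uniform geometric lattice of corank `M`. -/
noncomputable def augChowSeq (M : ℕ) (t : ℂ) (j : ℕ) : ℂ :=
  (1 + t) ^ j * (levels M (t / (1 + t) ^ 2) j).1 (M + j)

theorem three_term_telescope {t : ℂ} {a c : ℕ → ℂ} (K : ℕ)
    (h : ∀ i < K, t * c (i + 1) = t * a (i + 2) - (1 + t) * a (i + 1) + a i) :
    t * ∑ i ∈ Finset.range K, c (i + 1) = t * (a (K + 1) - a 1) - (a K - a 0) ∧
    ∑ i ∈ Finset.range K, t ^ (i + 1) * c (i + 1) =
      t ^ K * (a (K + 1) - a K) - (a 1 - a 0) := by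
  induction K with
  | zero => simp
  | succ K ih =>
    obtain ⟨h1, h2⟩ := ih fun i hi => h i (by omega)
    have h3 := h K (by omega)
    rw [Finset.sum_range_succ, Finset.sum_range_succ]
    exact ⟨by linear_combination h1 + h3, by linear_combination h2 + t ^ K * h3⟩

theorem augChowSeq_eq (M k : ℕ) {t : ℂ} (ht : 1 + t ≠ 0) :
    augChowSeq M t k = t * (chowSeq M t 0 +
        ∑ i ∈ Finset.range k, ((M + k).choose i : ℂ) * chowSeq M t (k - i)) + (1 - t) ∧
    augChowSeq M t k = t ^ k * chowSeq M t 0 +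
        ∑ i ∈ Finset.range k, ((M + k).choose i : ℂ) * (t ^ i * chowSeq M t (k - i)) := by
  rcases k with _ | K
  · simp [augChowSeq, chowSeq, levels]
  set w := t / (1 + t) ^ 2 with hw
  have hws : w * (1 + t) ^ 2 = t := div_mul_cancel₀ _ (pow_ne_zero _ ht)
  -- This sequence interpolates from the augmented Chow value `a 0` to `a (K + 1) = 1`, and `c`
  -- collects the Chow terms of positive rank.
  set a : ℕ → ℂ := fun i => (1 + t) ^ (K + 1 - i) *
    (prefixSum ^ i) (levels M w (K + 1 - i)).1 (M + (K + 1)) with ha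
  set c : ℕ → ℂ := fun i => ((M + (K + 1)).choose i : ℂ) * chowSeq M t (K + 1 - i) with hc
  have h : ∀ i < K, t * c (i + 1) = t * a (i + 2) - (1 + t) * a (i + 1) + a i := by
    intro i hi
    obtain ⟨r, rfl⟩ := Nat.exists_eq_add_of_lt hi
    have h3 := levels_three_term M r i hws
    simp only [ha, hc, chowSeq, ← hw]
    rw [show i + r + 1 + 1 - (i + 2) = r by omega, show i + r + 1 + 1 - (i + 1) = r + 1 by omega,
      show i + r + 1 + 1 - i = r + 2 by omega, show M + (i + r + 1 + 1) = M + r + i + 2 by omega,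
      if_neg (Nat.succ_ne_zero r), Nat.add_sub_cancel, show M + (r + 1) = M + 1 + r by omega]
    exact h3
  have h0 : c 0 = a 1 := by
    simp [ha, hc, chowSeq, hw]
  have hlast : a (K + 1) = 1 := by
    simp only [ha, Nat.sub_self, pow_zero, one_mul, levels]
    rw [prefixSum_pow_single M (K + 1) _ le_rfl, if_pos rfl]
  have hprev : a K = 1 + t := by
    have h1 : (levels M w 1).1 = prefixSum (fun j => if j = M then 1 else 0) := by
      rw [levels_succ_fst]
      congr 1
      funext j
      simp [levels]
    simp only [ha, Nat.add_sub_cancel_left, pow_one]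
    rw [h1, ← Module.End.mul_apply, ← pow_succ, prefixSum_pow_single M (K + 1) _ le_rfl,
      if_pos rfl, mul_one]
  have hG : augChowSeq M t (K + 1) = a 0 := by
    simp [augChowSeq, ha, hw]
  obtain ⟨h1, h2⟩ := three_term_telescope K h
  have hz : chowSeq M t 0 = 1 := if_pos rfl
  rw [hG, hz]
  constructor
  · change a 0 = t * (1 + ∑ i ∈ Finset.range (K + 1), c i) + (1 - t)
    rw [Finset.sum_range_succ', h0]
    rw [hlast, hprev] at h1
    linear_combination -h1
  · have h3 : ∀ i, ((M + (K + 1)).choose i : ℂ) * (t ^ i * chowSeq M t (K + 1 - i)) =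
        t ^ i * c i := fun i => by simp only [hc]; ring
    simp_rw [h3]
    rw [Finset.sum_range_succ', h0]
    rw [hlast, hprev] at h2
    linear_combination -h2

/-! ### Nonreal arguments and the conclusion. -/

/-- Otherwise `c (1 + t)² + t = 0`, a real equation of discriminant `4 c + 1 > 0` in `t` (linear if
`c = 0`), whose roots are real. -/
theorem div_one_add_sq_ne {t : ℂ} (ht : t.im ≠ 0) (h1 : 1 + t ≠ 0) (c : ℝ) (hc : 0 ≤ c) :
    t / (1 + t) ^ 2 ≠ -c := by
  intro h
  rw [div_eq_iff (pow_ne_zero _ h1)] at h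
  have hre := congrArg Complex.re h
  have him := congrArg Complex.im h
  simp only [pow_two, Complex.mul_re, Complex.mul_im, Complex.add_re, Complex.add_im,
    Complex.neg_re, Complex.neg_im, Complex.ofReal_re, Complex.ofReal_im, Complex.one_re,
    Complex.one_im] at hre him
  set x := t.re
  set y := t.im
  have h2 : 2 * c * (1 + x) = -1 := mul_right_cancel₀ ht (by linear_combination him)
  have hy : 0 < y ^ 2 := by positivity
  have h3 : 4 * c ^ 2 * y ^ 2 + 4 * c + 1 = 0 := by
    linear_combination -4 * c * hre + (2 * c * (1 + x) + 1) * h2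
  nlinarith [mul_nonneg (sq_nonneg c) hy.le]

theorem augChowSeq_ne_zero (M k : ℕ) {t : ℂ} (ht : t.im ≠ 0) : augChowSeq M t k ≠ 0 := by
  have h1 : 1 + t ≠ 0 := fun h => ht (by simpa using congrArg Complex.im h)
  exact mul_ne_zero (pow_ne_zero _ h1)
    (levels_last_ne_zero M (div_one_add_sq_ne ht h1) k)

namespace Poset.Uniform

variable {k n : ℕ}

theorem sum_Icc_chowSeq (hkn : k ≤ n) (A : Uniform k n) (t : ℂ) (φ : ℕ → ℂ) :
    ∑ B ∈ Finset.Icc A ⊤, φ (grade ℕ B - grade ℕ A) * chowSeq (n - k) t (k - grade ℕ B) =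
      φ (k - grade ℕ A) * chowSeq (n - k) t 0 +
        ∑ i ∈ Finset.range (k - grade ℕ A),
          ((n - k + (k - grade ℕ A)).choose i : ℂ) *
            (φ i * chowSeq (n - k) t (k - grade ℕ A - i)) := by
  by_cases hA : A = ⊤
  · subst hA
    simp [grade_top hkn]
  have hlt := card_lt_of_ne_top hkn hA
  rw [← grade_of_ne_top hA] at hlt
  have h := sum_Icc_top hkn hA fun i => φ i * chowSeq (n - k) t (k - grade ℕ A - i)
  simp only [nsmul_eq_mul, Nat.sub_self] at h
  rw [show n - k + (k - grade ℕ A) = n - grade ℕ A by omega, ← h]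
  refine Finset.sum_congr rfl fun B hB => ?_
  have hAB : grade ℕ A ≤ grade ℕ B := grade_mono (Finset.mem_Icc.1 hB).1
  rw [show k - grade ℕ A - (grade ℕ B - grade ℕ A) = k - grade ℕ B by omega]

theorem aeval_chow (hkn : k ≤ n) {t : ℂ} (h1 : 1 + t ≠ 0) (h2 : 1 - t ≠ 0) (A : Uniform k n) :
    aeval t (chow A ⊤) = chowSeq (n - k) t (k - grade ℕ A) := by
  induction A using WellFoundedGT.induction with
  | ind A ih =>
    have hG := congrArg (aeval t) (augChow_eq (le_top : A ≤ ⊤))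
    rw [augChow] at hG
    simp only [map_sum, map_mul, map_add, map_pow, map_sub, map_one, aeval_X] at hG
    obtain ⟨h3, h4⟩ := augChowSeq_eq (n - k) (k - grade ℕ A) h1
    have h5 := sum_Icc_chowSeq hkn A t fun i => t ^ i
    have h6 := sum_Icc_chowSeq hkn A t fun _ => 1
    simp only [one_mul] at h6
    rw [← h5] at h4
    rw [← h6] at h3
    simp only [← Finset.Ioc_insert_left (le_top : A ≤ ⊤),
      Finset.sum_insert Finset.left_notMem_Ioc, Nat.sub_self, pow_zero, one_mul] at hG h3 h4
    rw [Finset.sum_congr rfl fun B hB => by rw [ih B (Finset.mem_Ioc.1 hB).1],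
      Finset.sum_congr (g := fun B => chowSeq (n - k) t (k - grade ℕ B)) rfl
        fun B hB => ih B (Finset.mem_Ioc.1 hB).1] at hG
    -- Subtracting the two formulas leaves the term at `A` with coefficient `1 - t`; all terms above
    -- `A` agree by induction.
    exact mul_left_cancel₀ h2 (by linear_combination hG + h4 - h3)

theorem aeval_augChow (hkn : k ≤ n) {t : ℂ} (h1 : 1 + t ≠ 0) (h2 : 1 - t ≠ 0)
    (A : Uniform k n) :
    aeval t (augChow A ⊤) = augChowSeq (n - k) t (k - grade ℕ A) := by
  rw [(augChowSeq_eq (n - k) (k - grade ℕ A) h1).2, ← sum_Icc_chowSeq hkn A t fun i => t ^ i,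
    augChow]
  simp only [map_sum, map_mul, map_pow, aeval_X, aeval_chow hkn h1 h2]

end Poset.Uniform

/-- All complex zeros of the augmented Chow polynomial of `U_{k,n}` are real. -/
theorem theorem3 (k n : ℕ) (hkn : k ≤ n) (z : ℂ)
    (hz : Polynomial.aeval z (Poset.augmentedChowPolynomial (Poset.Uniform k n)) = 0) :
    z.im = 0 := by
  by_contra him
  have h1 : 1 + z ≠ 0 := fun h => him (by simpa using congrArg Complex.im h)
  have h2 : 1 - z ≠ 0 := fun h => him (by simpa using congrArg Complex.im h)
  rw [Poset.augmentedChowPolynomial, Poset.Uniform.aeval_augChow hkn h1 h2] at hz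
  exact augChowSeq_ne_zero _ _ him hz
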